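/- Let $g$ be a holomorphic parabolic germ at $0\in\mathbb C$ (that is, $g(0)=0$, $g'(0)=1$ and $0$ is an isolated fixed point), let $g^{-1}$ be the inverse germ, and let the Écalle–Voronin modulus of $g$ be $(k,b,[\Psi_{-k},\ldots,\Psi_{-1},\Psi_1,\ldots,\Psi_k])$. Then the modulus of $g^{-1}$ is $$(k,-b,[\widetilde\Psi_{-k},\ldots,\widetilde\Psi_{-1},\widetilde\Psi_1,\ldots,\widetilde\Psi_k]),\qquad \widetilde\Psi_j=L_{-1}\circ\Psi_{r_1^{-1}(j)}^{-1}\circ L_{-1},$$ where $L_{-1}(Y)=-Y$ and $r_1$ is the permutation of the indices induced by the rotation $y\mapsto e^{i\pi/k}y$. Here the modulus is defined as follows. Number the indices modulo $2k$ by $\Psi_{-j}=\Psi_{2k-j+1}$ ($1\le j\le k$). There is a holomorphic coordinate in which $g$ is prenormalized, $$g(z)=z+z^{k+1}+\Bigl(\tfrac{k+1}{2}-b\Bigr)z^{2k+1}+o(z^{2k+1}),\qquad k\ge 1 ;$$ $k$ is the codimension and $b\in\mathbb C$ the formal invariant. For $j\in\mathbb Z/2k$ put $Z_j(z)=-\frac1{kz^k}+b\log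 z-\frac{ji\pi b}{k}$, with $\arg z$ near $j\pi/k$ in the direction $e^{ij\pi/k}$. The petal $S_j$ is the set of points whose $g$-orbit in a small punctured disc meets the strip bounded, in the chart $Z_j$, by the vertical line through $Z_j(\delta e^{ij\pi/k})$ ($\delta>0$ small) and its image under $g$. A Fatou coordinate on $S_j$ is a holomorphic diffeomorphism $\varphi_j$ of $S_j$ onto its image with $\varphi_j\circ g=\varphi_j+1$. The transition functions are $\Psi_n=\varphi_n\circ\varphi_{n-1}^{-1}$ for $n\in\mathbb Z/2k$ odd and $\Psi_n=\varphi_{n-1}\circ\varphi_n^{-1}$ for $n$ even; they are regarded as germs at the end $\operatorname{Im}W\to+\infty$ for $n$ odd and $\operatorname{Im}W\to-\infty$ for $n$ even. They are normalized if the constant term of $\Psi_n(W)-W$ is $-i\pi b/k$ for $n$ odd and $i\pi b/k$ for $n$ even. Finally $[\,\cdot\,]$ is the class of normalized tuples modulo $\Psi_n\mapsto T_C\circ\Psi_n\circ T_{-C}$ for all $n$ (one $C\in\mathbb C$, $T_C(W)=W+C$) and modulo the index shifts $n\mapsto n+2m$, $m\in\mathbb Z$. A rotation $u$ induces the permutation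 with $u^{-1}(\Delta_n)=\Delta_{u(n)}$, where $\Delta_n$ is the sector $(n-1)\pi/k<\arg z<n\pi/k$; thus $r_1(n)=n-1$ modulo $2k$. -/

import Mathlib

open Filter Topology

noncomputable section

namespace EcalleVoronin

/-! ### Parabolic germs -/

/-- `g` represents a holomorphic parabolic germ at `0`: multiplier `1`, isolated fixed point. -/
structure IsParabolicGerm (g : ℂ → ℂ) : Prop where
  analyticAt : AnalyticAt ℂ g 0
  map_zero : g 0 = 0
  deriv_eq_one : deriv g 0 = 1
  isolated : ∀ᶠ z in 𝓝[≠] (0 : ℂ), g z ≠ z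

/-- `g'` represents the inverse germ at `0` of the germ of `g`. -/
structure IsInverseGerm (g g' : ℂ → ℂ) : Prop where
  analyticAt : AnalyticAt ℂ g' 0
  map_zero : g' 0 = 0
  left_inv : ∀ᶠ z in 𝓝 (0 : ℂ), g' (g z) = z
  right_inv : ∀ᶠ z in 𝓝 (0 : ℂ), g (g' z) = z

/-- The germ `g` of codimension `k` and formal invariant `b` is prenormalized:
`g z = z + z ^ (k + 1) + ((k + 1) / 2 - b) z ^ (2 k + 1) + o (z ^ (2 k + 1))`. -/
structure IsPrenormalized (k : ℕ) (b : ℂ) (g : ℂ → ℂ) : Prop where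
  analyticAt : AnalyticAt ℂ g 0
  expansion :
    (fun z : ℂ => g z - (z + z ^ (k + 1) + (((k : ℂ) + 1) / 2 - b) * z ^ (2 * k + 1)))
      =o[𝓝 0] fun z : ℂ => z ^ (2 * k + 1)

/-! ### Time coordinates and petals

The `2k` petals are indexed by `ℤ / 2k`; the petal `j` is centred on the direction
`exp (i π j / k)`. Petals with even index are repelling, those with odd index attracting. -/

/-- The direction `exp (i π j / k)`. -/
def direction (k : ℕ) (j : ZMod (2 * k)) : ℂ :=
  Complex.exp (Real.pi * Complex.I * (j.val : ℂ) / (k : ℂ))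

/-- The time chart `Z_j(z) = -1 / (k z ^ k) + b log z - j i π b / k`, with the branch of `log`
whose argument is continued from the value `j π / k` on the direction `j`. With the principal
branch `Log` this is `-1 / (k z ^ k) + b Log (z / exp (i π j / k))`, which only depends on `j`
modulo `2k`. -/
def timeChart (k : ℕ) (b : ℂ) (j : ZMod (2 * k)) (z : ℂ) : ℂ :=
  -1 / ((k : ℂ) * z ^ k) + b * Complex.log (z / direction k j)

/-- The open sector of half-opening `π / k` around the direction `j`, on which the chart `Z_j`
is used to draw the strip. -/
def sector (k : ℕ) (j : ZMod (2 * k)) : Set ℂ :=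
  {z | z ≠ 0 ∧ |Complex.arg (z / direction k j)| < Real.pi / k}

/-- The punctured disc of radius `r`. -/
def puncturedDisc (r : ℝ) : Set ℂ := {z | z ≠ 0 ∧ ‖z‖ < r}

/-- One step of an orbit of `g` that stays in the punctured disc of radius `r`. -/
def Step (g : ℂ → ℂ) (r : ℝ) (z w : ℂ) : Prop :=
  z ∈ puncturedDisc r ∧ w ∈ puncturedDisc r ∧ w = g z

/-- The closed strip `B_j`, seen in the `z`-coordinate: the points lying, in the chart `Z_j`,
between the vertical line `ℓ_j` through `Z_j (δ exp (i π j / k))` and its image under `g`. -/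
def strip (k : ℕ) (b : ℂ) (g : ℂ → ℂ) (r δ : ℝ) (j : ZMod (2 * k)) : Set ℂ :=
  {z | z ∈ sector k j ∧ ∃ w ∈ sector k j, Step g r w z ∧
    (timeChart k b j w).re ≤ (timeChart k b j (δ * direction k j)).re ∧
    (timeChart k b j (δ * direction k j)).re ≤ (timeChart k b j z).re}

/-- The petal `S_j`: the points of which some iterate `g ^ n`, `n ∈ ℤ`, lies in the strip `B_j`,
the orbit being taken in the punctured disc of radius `r`. -/
def petal (k : ℕ) (b : ℂ) (g : ℂ → ℂ) (r δ : ℝ) (j : ZMod (2 * k)) : Set ℂ :=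
  {z | ∃ p ∈ strip k b g r δ j,
    Relation.ReflTransGen (Step g r) z p ∨ Relation.ReflTransGen (Step g r) p z}

/-! ### Fatou coordinates and transition functions -/

/-- `φ` is a Fatou coordinate of `g` on the domain `S`, read in the `z`-coordinate (that is,
`φ = Φ_j ∘ Z_j`): a holomorphic diffeomorphism onto its image conjugating `g` to `W ↦ W + 1`. -/
structure IsFatouCoordinate (g : ℂ → ℂ) (S : Set ℂ) (φ : ℂ → ℂ) : Prop where
  isOpen : IsOpen S
  differentiableOn : DifferentiableOn ℂ φ S
  injOn : Set.InjOn φ S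
  deriv_ne_zero : ∀ z ∈ S, deriv φ z ≠ 0
  abel : ∀ z ∈ S, g z ∈ S → φ (g z) = φ z + 1

/-- Tuples of transition functions, indexed by `ℤ / 2k`. With the indices
`-k, …, -1, 1, …, k`, the entry `n = 1, …, k` is `Ψ_n`, and `Ψ_{-j}`, `1 ≤ j ≤ k`, is the entry
`2k - j + 1`. Thus the entry `n` compares the petals `n - 1` and `n`. -/
abbrev TransitionTuple (k : ℕ) : Type := ZMod (2 * k) → ℂ → ℂ

/-- The end of the Fatou coordinate plane at which the entry `n` is defined:
`Im W → +∞` for `n` odd and `Im W → -∞` for `n` even. -/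
def hornEnd (k : ℕ) (n : ZMod (2 * k)) : Filter ℂ :=
  open Classical in
  if Even n then comap Complex.im atBot else comap Complex.im atTop

/-- The repelling one of the petals `n - 1`, `n`. -/
def sourcePetal (k : ℕ) (n : ZMod (2 * k)) : ZMod (2 * k) :=
  open Classical in if Even n then n else n - 1

/-- The attracting one of the petals `n - 1`, `n`. -/
def targetPetal (k : ℕ) (n : ZMod (2 * k)) : ZMod (2 * k) :=
  open Classical in if Even n then n - 1 else n

/-- The constant term prescribed by the normalization: `-i π b / k` for `n` odd,
`i π b / k` for `n` even. -/
def normalizedConstant (k : ℕ) (b : ℂ) (n : ZMod (2 * k)) : ℂ :=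
  open Classical in
  if Even n then Complex.I * Real.pi * b / k else -(Complex.I * Real.pi * b / k)

/-- `Ψ` is a tuple of transition functions of the prenormalized germ `g`: for all small enough
discs and all small enough `δ` there are Fatou coordinates `φ_j` on the petals such that, on a
half-plane at the end of index `n`, `Ψ_n = φ_t ∘ φ_s⁻¹` on the intersection of the source petal
`s` and the target petal `t`. -/
def IsTransitionTuple (k : ℕ) (b : ℂ) (g : ℂ → ℂ) (Ψ : TransitionTuple k) : Prop :=
  ∀ᶠ r in 𝓝[>] (0 : ℝ), ∀ᶠ δ in 𝓝[>] (0 : ℝ), ∃ φ : ZMod (2 * k) → ℂ → ℂ,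
    (∀ j, IsFatouCoordinate g (petal k b g r δ j) (φ j)) ∧
    ∀ n, ∀ᶠ W in hornEnd k n,
      ∃ z ∈ petal k b g r δ (sourcePetal k n) ∩ petal k b g r δ (targetPetal k n),
        φ (sourcePetal k n) z = W ∧ φ (targetPetal k n) z = Ψ n W

/-- The constant term of the Fourier expansion of `Ψ_n(W) - W`, which is its limit at the end of
index `n`, has the normalized value, for every `n`. -/
def IsNormalized (k : ℕ) (b : ℂ) (Ψ : TransitionTuple k) : Prop :=
  ∀ n, Tendsto (fun W => Ψ n W - W) (hornEnd k n) (𝓝 (normalizedConstant k b n))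

/-! ### The modulus -/

theorem even_add_two_mul_iff {k : ℕ} (n m : ZMod (2 * k)) : Even (n + 2 * m) ↔ Even n := by
  constructor
  · intro h
    have h2 : n = (n + 2 * m) - 2 * m := by ring
    rw [h2]
    exact h.sub (even_two_mul m)
  · intro h
    exact h.add (even_two_mul m)

theorem hornEnd_add_two_mul {k : ℕ} (n m : ZMod (2 * k)) :
    hornEnd k (n + 2 * m) = hornEnd k n := by
  by_cases h : Even n
  · have h' := (even_add_two_mul_iff n m).2 h
    simp only [hornEnd, if_pos h, if_pos h']
  · have h' := fun h2 => h ((even_add_two_mul_iff n m).1 h2)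
    simp only [hornEnd, if_neg h, if_neg h']

theorem tendsto_sub_hornEnd {k : ℕ} (n : ZMod (2 * k)) (C : ℂ) :
    Tendsto (fun W => W - C) (hornEnd k n) (hornEnd k n) := by
  unfold hornEnd
  split_ifs
  · rw [tendsto_comap_iff]
    have : (Complex.im ∘ fun W : ℂ => W - C) = fun W : ℂ => W.im + -C.im := by
      funext W; simp [sub_eq_add_neg]
    rw [this]
    exact tendsto_atBot_add_const_right _ _ tendsto_comap
  · rw [tendsto_comap_iff]
    have : (Complex.im ∘ fun W : ℂ => W - C) = fun W : ℂ => W.im + -C.im := by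
      funext W; simp [sub_eq_add_neg]
    rw [this]
    exact tendsto_atTop_add_const_right _ _ tendsto_comap

/-- Transition functions are germs at their ends, identified under a common translation `T_C`,
`C ∈ ℂ`, of all Fatou coordinates, `Ψ_n = T_C ∘ Ψ'_n ∘ T_{-C}`, and under the shifts
`n ↦ n + 2m` of the indices coming from the rotations of order `k`. -/
def Equivalent {k : ℕ} (Ψ Ψ' : TransitionTuple k) : Prop :=
  ∃ (m : ZMod (2 * k)) (C : ℂ), ∀ n,
    Ψ n =ᶠ[hornEnd k n] fun W => Ψ' (n + 2 * m) (W - C) + C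

instance transitionSetoid (k : ℕ) : Setoid (TransitionTuple k) where
  r := Equivalent
  iseqv := by
    refine ⟨fun Ψ => ⟨0, 0, fun n => by simp [EventuallyEq]⟩, ?_, ?_⟩
    · rintro Ψ Ψ' ⟨m, C, h⟩
      refine ⟨-m, -C, fun n => ?_⟩
      have h1 := h (n + 2 * (-m))
      rw [hornEnd_add_two_mul] at h1
      have h2 := (tendsto_sub_hornEnd n (-C)).eventually h1
      filter_upwards [h2] with W hW
      rw [hW]
      have e : n + 2 * (-m) + 2 * m = n := by ring
      rw [e]
      simp
    · rintro Ψ Ψ' Ψ'' ⟨m, C, h⟩ ⟨m', C', h'⟩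
      refine ⟨m + m', C + C', fun n => ?_⟩
      have h1 := h' (n + 2 * m)
      rw [hornEnd_add_two_mul] at h1
      have h2 := (tendsto_sub_hornEnd n C).eventually h1
      filter_upwards [h n, h2] with W hW hW'
      rw [hW, hW']
      have e : n + 2 * m + 2 * m' = n + 2 * (m + m') := by ring
      have e' : W - C - C' = W - (C + C') := by ring
      rw [e, e']
      ring

/-- The triples `(k, b, [Ψ])`. -/
structure Modulus where
  codim : ℕ
  formalInvariant : ℂ
  analyticInvariant : Quotient (transitionSetoid codim)

/-- The Écalle–Voronin modulus of the germ `g` is `M = (k, b, [Ψ])`: in some coordinate `h` in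
which `g` becomes a prenormalized germ of codimension `k ≥ 1` and formal invariant `b`, the
tuple `Ψ` is a representative of normalized transition functions. -/
def HasModulus (g : ℂ → ℂ) (M : Modulus) : Prop :=
  1 ≤ M.codim ∧ ∃ h G : ℂ → ℂ,
    AnalyticAt ℂ h 0 ∧ h 0 = 0 ∧ deriv h 0 ≠ 0 ∧
    (∀ᶠ z in 𝓝 (0 : ℂ), h (g z) = G (h z)) ∧
    IsPrenormalized M.codim M.formalInvariant G ∧
    ∃ Ψ : TransitionTuple M.codim,
      IsTransitionTuple M.codim M.formalInvariant G Ψ ∧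
      IsNormalized M.codim M.formalInvariant Ψ ∧
      M.analyticInvariant = ⟦Ψ⟧

/-! ### The inverse tuple -/

/-- The inverse of the germ of `Ψ` along `l`, when `Ψ` is injective on some member of `l`. -/
def germInverse (l : Filter ℂ) (Ψ : ℂ → ℂ) : ℂ → ℂ :=
  open Classical in
  if h : ∃ s ∈ l, Set.InjOn Ψ s then Function.invFunOn Ψ h.choose else id

theorem germInverse_comp {l : Filter ℂ} {Ψ : ℂ → ℂ} (h : ∃ s ∈ l, Set.InjOn Ψ s) :
    ∀ᶠ W in l, germInverse l Ψ (Ψ W) = W := by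
  filter_upwards [h.choose_spec.1] with W hW
  rw [germInverse, dif_pos h]
  exact h.choose_spec.2.leftInvOn_invFunOn hW

/-- The permutation `r_1` of the indices induced by the rotation `y ↦ exp (i π / k) y`. If `Δ_n`
is the sector between the directions `n - 1` and `n`, a rotation `u` induces the permutation
with `u⁻¹ (Δ_n) = Δ_{u n}`; here `exp (-i π / k) Δ_n = Δ_{n - 1}`. -/
def indexRotation (k : ℕ) : Equiv.Perm (ZMod (2 * k)) := Equiv.subRight 1

/-- `Ψ̃_n = L_{-1} ∘ Ψ_{r_1⁻¹ n}⁻¹ ∘ L_{-1}`, where `L_{-1} Y = -Y`. -/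
def inverseTuple {k : ℕ} (Ψ : TransitionTuple k) : TransitionTuple k := fun n W =>
  -germInverse (hornEnd k ((indexRotation k).symm n)) (Ψ ((indexRotation k).symm n)) (-W)

/-- The opposite convention for the permutation induced by a rotation gives the same class. -/
theorem inverseTuple_class_eq {k : ℕ} (Ψ : TransitionTuple k) :
    (⟦inverseTuple Ψ⟧ : Quotient (transitionSetoid k)) =
      ⟦fun n W => -germInverse (hornEnd k (indexRotation k n)) (Ψ (indexRotation k n)) (-W)⟧ := by
  refine Quotient.sound ⟨1, 0, fun n => Eventually.of_forall fun W => ?_⟩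
  have e : n + 2 * 1 - 1 = n + 1 := by ring
  simp only [inverseTuple, indexRotation, Equiv.subRight_apply, Equiv.subRight_symm_apply, e,
    sub_zero, add_zero]

end EcalleVoronin

end

noncomputable section

namespace EcalleVoronin

/-! Let `G` be the prenormalized form of `g`, and `F` its inverse. The expansion of `F` starts with
`z - z ^ (k + 1)`, which has the wrong sign. Conjugating by the rotation `y = ρ z`, where `ρ = exp
(-i π / k)` and `ρ ^ k = -1`, restores the sign and turns `b` into `-b`
(`IsPrenormalized.rotated_inverse`).

The same rotation turns the chart `Z_(j+1)` into `-Z_j` for `-b` (`timeChart_div`), while passing to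
the inverse reverses orbits. Hence petal `j` of the rotated inverse is the rotated petal `j + 1` of
`G` (`mem_petal_rotated_iff`), with Fatou coordinate `-φ_(j+1) (y / ρ)`. Attracting and repelling
petals are exchanged, so each transition function is inverted and conjugated by `W ↦ -W`, with index
shifted by one.

The analytic point is that `germInverse` is a genuine inverse at an end: the transition functions
are injective there because Fatou coordinates are, and onto by a quantitative open mapping argument
(`hornEnd_le_map`). -/

/-! ### Germs of bijections along a filter -/

/-- `Ψ` is injective on a member of `l` and maps members of `l` onto members of `l`. -/
structure IsGermIso (l : Filter ℂ) (Ψ : ℂ → ℂ) : Prop where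
  injOn : ∃ s ∈ l, Set.InjOn Ψ s
  le_map : l ≤ map Ψ l

/-- Images of members of `l` are again members, so near the end every `V` is `Ψ U` with `U` as good
as desired. Later proofs use this to substitute `V = Ψ U`. -/
theorem IsGermIso.eventually_germInverse {l : Filter ℂ} {Ψ : ℂ → ℂ} (h : IsGermIso l Ψ)
    {p : ℂ → Prop} (hp : ∀ᶠ U in l, p U) :
    ∀ᶠ V in l, p (germInverse l Ψ V) ∧ Ψ (germInverse l Ψ V) = V := by
  have h1 : Ψ '' {U | p U ∧ germInverse l Ψ (Ψ U) = U} ∈ l :=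
    h.le_map (image_mem_map (hp.and (germInverse_comp h.injOn)))
  filter_upwards [h1]
  rintro _ ⟨U, ⟨hU, hU'⟩, rfl⟩
  rw [hU']
  exact ⟨hU, rfl⟩

theorem IsGermIso.tendsto_germInverse {l : Filter ℂ} {Ψ : ℂ → ℂ} (h : IsGermIso l Ψ) :
    Tendsto (germInverse l Ψ) l l :=
  fun _ hs => (h.eventually_germInverse hs).mono fun _ hV => hV.1

theorem IsGermIso.congr {l : Filter ℂ} {Ψ Ψ' : ℂ → ℂ} (h : IsGermIso l Ψ) (e : Ψ =ᶠ[l] Ψ') :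
    IsGermIso l Ψ' := by
  obtain ⟨s, hs, hinj⟩ := h.injOn
  refine ⟨⟨s ∩ {W | Ψ W = Ψ' W}, inter_mem hs e, ?_⟩, ?_⟩
  · intro x hx y hy hxy
    exact hinj hx.1 hy.1 (by rw [hx.2, hy.2, hxy])
  · rw [← Filter.map_congr e]
    exact h.le_map

theorem IsGermIso.conj_add {l : Filter ℂ} {Ψ : ℂ → ℂ} (h : IsGermIso l Ψ) {C : ℂ}
    (hC : Tendsto (fun W => W - C) l l) (hC' : Tendsto (fun W => W + C) l l) :
    IsGermIso l fun W => Ψ (W - C) + C := by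
  obtain ⟨s, hs, hinj⟩ := h.injOn
  refine ⟨⟨_, hC hs, ?_⟩, ?_⟩
  · intro x hx y hy hxy
    simpa using hinj hx hy (by simpa using hxy)
  · intro t ht
    have h1 : ∀ᶠ W in l, Ψ W + C ∈ t := by
      filter_upwards [hC' (mem_map.1 ht)] with W hW
      simpa using hW
    have h2 : {V | V + C ∈ t} ∈ l := h.le_map h1
    filter_upwards [hC h2] with W hW
    simpa using hW

/-! ### The ends of the Fatou coordinate planes -/

/-- Half-planes at an end absorb bounded displacements; this supplies discs of fixed radius for
local arguments. -/
theorem hornEnd_eventually_closedBall {k : ℕ} {n : ZMod (2 * k)} {p : ℂ → Prop}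
    (h : ∀ᶠ W in hornEnd k n, p W) (R : ℝ) :
    ∀ᶠ W in hornEnd k n, ∀ U ∈ Metric.closedBall W R, p U := by
  have him : ∀ W U : ℂ, U ∈ Metric.closedBall W R → |U.im - W.im| ≤ R := fun W U hU => by
    rw [← Complex.sub_im]
    exact (Complex.abs_im_le_norm _).trans (by simpa [dist_eq_norm] using hU)
  unfold hornEnd at *
  split_ifs at *
  · rw [(atBot_basis.comap Complex.im).eventually_iff] at *
    obtain ⟨M, -, hM⟩ := h
    refine ⟨M - R, trivial, fun W hW U hU => hM ?_⟩
    have := abs_le.1 (him W U hU)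
    simp only [Set.mem_preimage, Set.mem_Iic] at *
    linarith
  · rw [(atTop_basis.comap Complex.im).eventually_iff] at *
    obtain ⟨M, -, hM⟩ := h
    refine ⟨M + R, trivial, fun W hW U hU => hM ?_⟩
    have := abs_le.1 (him W U hU)
    simp only [Set.mem_preimage, Set.mem_Ici] at *
    linarith

theorem tendsto_add_hornEnd {k : ℕ} (n : ZMod (2 * k)) (C : ℂ) :
    Tendsto (fun W => W + C) (hornEnd k n) (hornEnd k n) := by
  simpa using tendsto_sub_hornEnd n (-C)

theorem even_add_one_iff {k : ℕ} [NeZero k] (n : ZMod (2 * k)) : Even (n + 1) ↔ ¬ Even n := by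
  constructor
  · rintro h h'
    have h1 : Even (1 : ZMod (2 * k)) := by simpa using h.sub h'
    -- Parity makes sense modulo `2 * k` because it factors through `ZMod 2`, where `1` is not even.
    have h2 := h1.map (ZMod.castHom (dvd_mul_right 2 k) (ZMod 2))
    rw [map_one] at h2
    obtain ⟨a, ha⟩ := h2
    revert a
    decide
  · intro h
    rw [← ZMod.natCast_zmod_val n] at h ⊢
    rcases Nat.even_or_odd n.val with h' | h'
    · exact absurd (h'.map (Nat.castRingHom (ZMod (2 * k)))) h
    · exact_mod_cast (h'.add_one).map (Nat.castRingHom (ZMod (2 * k)))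

theorem tendsto_neg_hornEnd {k : ℕ} [NeZero k] (n : ZMod (2 * k)) :
    Tendsto (fun W => -W) (hornEnd k n) (hornEnd k (n + 1)) := by
  have e : (Complex.im ∘ fun W : ℂ => -W) = fun W : ℂ => -W.im := by
    funext W; simp
  by_cases h : Even n
  · have h' : ¬ Even (n + 1) := fun h2 => (even_add_one_iff n).1 h2 h
    rw [hornEnd, hornEnd, if_pos h, if_neg h', tendsto_comap_iff, e]
    exact tendsto_neg_atBot_atTop.comp tendsto_comap
  · have h' : Even (n + 1) := (even_add_one_iff n).2 h
    rw [hornEnd, hornEnd, if_neg h, if_pos h', tendsto_comap_iff, e]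
    exact tendsto_neg_atTop_atBot.comp tendsto_comap

theorem normalizedConstant_add_one {k : ℕ} [NeZero k] (b : ℂ) (n : ZMod (2 * k)) :
    normalizedConstant k b (n + 1) = normalizedConstant k (-b) n := by
  by_cases h : Even n
  · have h' : ¬ Even (n + 1) := fun h2 => (even_add_one_iff n).1 h2 h
    rw [normalizedConstant, normalizedConstant, if_pos h, if_neg h']
    ring
  · have h' : Even (n + 1) := (even_add_one_iff n).2 h
    rw [normalizedConstant, normalizedConstant, if_neg h, if_pos h']
    ring

/-- A shift by one changes the parity of a petal, so repelling and attracting petals exchange roles.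
-/
theorem sourcePetal_add_one {k : ℕ} [NeZero k] (n : ZMod (2 * k)) :
    sourcePetal k (n + 1) = targetPetal k n + 1 := by
  by_cases h : Even n
  · have h' : ¬ Even (n + 1) := fun h2 => (even_add_one_iff n).1 h2 h
    rw [sourcePetal, targetPetal, if_pos h, if_neg h']
    ring
  · have h' : Even (n + 1) := (even_add_one_iff n).2 h
    rw [sourcePetal, targetPetal, if_neg h, if_pos h']

theorem targetPetal_add_one {k : ℕ} [NeZero k] (n : ZMod (2 * k)) :
    targetPetal k (n + 1) = sourcePetal k n + 1 := by
  by_cases h : Even n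
  · have h' : ¬ Even (n + 1) := fun h2 => (even_add_one_iff n).1 h2 h
    rw [sourcePetal, targetPetal, if_pos h, if_neg h']
  · have h' : Even (n + 1) := (even_add_one_iff n).2 h
    rw [sourcePetal, targetPetal, if_neg h, if_pos h']
    ring

/-- A holomorphic function asymptotic to a translation at an end is onto near that end. -/
theorem hornEnd_le_map {k : ℕ} {n : ZMod (2 * k)} {Ψ : ℂ → ℂ} {c : ℂ}
    (hd : ∀ᶠ W in hornEnd k n, DifferentiableAt ℂ Ψ W)
    (hc : Tendsto (fun W => Ψ W - W) (hornEnd k n) (𝓝 c)) :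
    hornEnd k n ≤ map Ψ (hornEnd k n) := by
  intro t ht
  have hsmall : ∀ᶠ W in hornEnd k n, ‖Ψ W - W - c‖ < 1 / 2 := by
    filter_upwards [hc (Metric.ball_mem_nhds c one_half_pos)] with W hW
    simpa [dist_eq_norm] using hW
  -- On the circle of radius `4` about `V - c` the values of `Ψ` stay at distance at least `4 - 1 =
  -- 3` from `Ψ (V - c)`. The image therefore contains the disc of radius `3 / 2` about that value,
  -- and `V` lies within `1 / 2` of it.
  have hev := hornEnd_eventually_closedBall (hd.and (hsmall.and (mem_map.1 ht))) 4
  filter_upwards [tendsto_sub_hornEnd n c hev] with V hV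
  replace hV : ∀ U ∈ Metric.closedBall (V - c) 4,
    DifferentiableAt ℂ Ψ U ∧ ‖Ψ U - U - c‖ < 1 / 2 ∧ Ψ U ∈ t := hV
  have h0 := hV (V - c) (Metric.mem_closedBall_self (by norm_num))
  have hdist : ∀ z ∈ Metric.closedBall (V - c) 4,
      ‖z - (V - c)‖ - 1 ≤ ‖Ψ z - Ψ (V - c)‖ := by
    intro z hz
    have e : z - (V - c) = (Ψ z - Ψ (V - c)) - (Ψ z - z - c) + (Ψ (V - c) - (V - c) - c) := by
      ring
    have h1 := (norm_add_le ((Ψ z - Ψ (V - c)) - (Ψ z - z - c)) (Ψ (V - c) - (V - c) - c)).trans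
      (add_le_add_left (norm_sub_le _ _) _)
    rw [← e] at h1
    have := (hV z hz).2.1
    linarith [h0.2.1]
  have hball : Metric.ball (Ψ (V - c)) (3 / 2) ⊆ Ψ '' Metric.closedBall (V - c) 4 := by
    refine DiffContOnCl.ball_subset_image_closedBall (ε := 3) ?_ (by norm_num) ?_ ?_
    · apply DifferentiableOn.diffContOnCl
      rw [closure_ball _ (by norm_num)]
      exact fun z hz => (hV z hz).1.differentiableWithinAt
    · intro z hz
      have := hdist z (Metric.sphere_subset_closedBall hz)
      rw [mem_sphere_iff_norm.1 hz] at this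
      linarith
    -- Open mapping needs `Ψ` not locally constant at the centre: otherwise the identity theorem
    -- would make it constant on the disc, contradicting its value at `V - c + 2`.
    · have hne : ∀ᶠ z in 𝓝 (V - c + 2), Ψ z ≠ Ψ (V - c) := by
        filter_upwards [Metric.ball_mem_nhds (V - c + 2) one_half_pos] with z hz heq
        have h1 : ‖z - (V - c + 2)‖ < 1 / 2 := by simpa [dist_eq_norm] using hz
        have e2 : ‖(2 : ℂ)‖ = 2 := by simp
        have h2 : ‖z - (V - c)‖ ≤ ‖z - (V - c + 2)‖ + ‖(2 : ℂ)‖ := by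
          refine le_trans (le_of_eq ?_) (norm_add_le _ _)
          congr 1; ring
        have h3 : ‖(2 : ℂ)‖ ≤ ‖z - (V - c)‖ + ‖z - (V - c + 2)‖ := by
          refine le_trans (le_of_eq ?_) (norm_sub_le _ _)
          congr 1; ring
        have h4 := hdist z (by rw [Metric.mem_closedBall, dist_eq_norm]; linarith)
        rw [heq, sub_self, norm_zero] at h4
        linarith
      by_contra hcon
      rw [not_frequently] at hcon
      have han : AnalyticOnNhd ℂ Ψ (Metric.ball (V - c) 4) :=
        DifferentiableOn.analyticOnNhd
          (fun z hz => (hV z (Metric.ball_subset_closedBall hz)).1.differentiableWithinAt)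
          Metric.isOpen_ball
      have heq := han.eqOn_of_preconnected_of_eventuallyEq (analyticOnNhd_const (v := Ψ (V - c)))
        (convex_ball _ _).isPreconnected (Metric.mem_ball_self (by norm_num))
        (hcon.mono fun z hz => not_not.1 hz)
      refine hne.self_of_nhds (heq ?_)
      simp [dist_eq_norm]
      norm_num
  obtain ⟨U, hU, rfl⟩ := hball (show V ∈ Metric.ball (Ψ (V - c)) (3 / 2) by
    rw [Metric.mem_ball', dist_eq_norm]
    have e : Ψ (V - c) - V = Ψ (V - c) - (V - c) - c := by ring
    rw [e]
    linarith [h0.2.1])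
  exact (hV U hU).2.2

/-! ### The inverse of a prenormalized germ -/

theorem IsPrenormalized.exists_eq {k : ℕ} {b : ℂ} {G : ℂ → ℂ} (h : IsPrenormalized k b G) :
    ∃ e : ℂ → ℂ, Tendsto e (𝓝 0) (𝓝 (((k : ℂ) + 1) / 2 - b)) ∧
      ∀ᶠ w in 𝓝 (0 : ℂ), G w = w + w ^ (k + 1) + e w * w ^ (2 * k + 1) := by
  obtain ⟨φ, hφ, heq⟩ := h.expansion.exists_eq_mul
  refine ⟨fun w => ((k : ℂ) + 1) / 2 - b + φ w, ?_, ?_⟩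
  · simpa using tendsto_const_nhds.add hφ
  · filter_upwards [heq] with w hw
    simp only [Pi.mul_apply] at hw
    linear_combination hw

theorem IsPrenormalized.map_zero {k : ℕ} {b : ℂ} {G : ℂ → ℂ} (h : IsPrenormalized k b G) :
    G 0 = 0 := by
  obtain ⟨e, -, he⟩ := h.exists_eq
  simpa using he.self_of_nhds

theorem IsPrenormalized.hasDerivAt {k : ℕ} [NeZero k] {b : ℂ} {G : ℂ → ℂ}
    (h : IsPrenormalized k b G) : HasDerivAt G 1 0 := by
  have h1 : HasDerivAt (fun z : ℂ => z + z ^ (k + 1) +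
      (((k : ℂ) + 1) / 2 - b) * z ^ (2 * k + 1)) 1 0 := by
    have := ((hasDerivAt_id (0 : ℂ)).add (hasDerivAt_pow (k + 1) (0 : ℂ))).add
      ((hasDerivAt_pow (2 * k + 1) (0 : ℂ)).const_mul (((k : ℂ) + 1) / 2 - b))
    have hk : k ≠ 0 := NeZero.ne k
    exact this.congr_deriv (by simp [hk])
  have h2 : HasDerivAt (fun z : ℂ => G z - (z + z ^ (k + 1) +
      (((k : ℂ) + 1) / 2 - b) * z ^ (2 * k + 1))) 0 0 := by
    rw [hasDerivAt_iff_isLittleO]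
    simp only [h.map_zero, sub_zero, smul_zero]
    refine (h.expansion.congr_left fun z => by simp).trans_isBigO ?_
    refine Asymptotics.IsBigO.of_bound 1 ?_
    filter_upwards [Metric.ball_mem_nhds (0 : ℂ) one_pos] with z hz
    have hz' : ‖z‖ ≤ 1 := by simpa using (Metric.mem_ball.1 hz).le
    rw [norm_pow, one_mul]
    exact pow_le_of_le_one (norm_nonneg _) hz' (by omega)
  exact ((h2.add h1).congr_deriv (zero_add 1)).congr_of_eventuallyEq
    (Eventually.of_forall fun z => by simp)

theorem IsPrenormalized.exists_inverse {k : ℕ} [NeZero k] {b : ℂ} {G : ℂ → ℂ}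
    (h : IsPrenormalized k b G) : ∃ F, IsInverseGerm G F := by
  have hd : deriv G 0 ≠ 0 := by rw [h.hasDerivAt.deriv]; exact one_ne_zero
  have hs := h.analyticAt.hasStrictDerivAt
  have h0 := h.map_zero
  refine ⟨hs.localInverse _ _ _ hd, ?_, ?_, hs.eventually_left_inverse hd, ?_⟩
  · simpa [h0] using h.analyticAt.analyticAt_localInverse hd
  · simpa [h0] using (hs.eventually_left_inverse hd).self_of_nhds
  · simpa [h0] using hs.eventually_right_inverse hd

theorem pow_one_add_expansion (m : ℕ) :
    ∃ ψ : ℂ → ℂ, Tendsto ψ (𝓝 0) (𝓝 0) ∧ ∀ u : ℂ, (1 + u) ^ (m + 1) = 1 + (m + 1) * u + ψ u * u := by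
  -- At `u = 0` any `c` solves the equation; choosing `0` makes the limit valid along `𝓝 0`, centre
  -- included.
  have h1 : ∀ u : ℂ, ∃ c, (1 + u) ^ (m + 1) = 1 + (m + 1) * u + c * u ∧ (u = 0 → c = 0) := by
    intro u
    by_cases hu : u = 0
    · exact ⟨0, by simp [hu], fun _ => rfl⟩
    · exact ⟨((1 + u) ^ (m + 1) - 1 - (m + 1) * u) / u, by field_simp; ring, fun h => absurd h hu⟩
  choose ψ hψ h0 using h1
  refine ⟨ψ, ?_, hψ⟩
  have h2 : HasDerivAt (fun u : ℂ => (1 + u) ^ (m + 1)) (m + 1) 0 := by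
    exact (((hasDerivAt_id (0 : ℂ)).const_add 1).pow (m + 1)).congr_deriv (by simp)
  rw [hasDerivAt_iff_isLittleO, Asymptotics.isLittleO_iff] at h2
  rw [Metric.tendsto_nhds]
  intro ε hε
  filter_upwards [h2 (half_pos hε)] with u hu
  rw [dist_zero_right]
  by_cases hu0 : u = 0
  · simpa [h0 u hu0] using hε
  · have e : (1 + u) ^ (m + 1) - (1 + 0) ^ (m + 1) - (u - 0) • ((m : ℂ) + 1) = ψ u * u := by
      rw [hψ]; simp only [smul_eq_mul]; ring
    rw [e, norm_mul, sub_zero] at hu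
    have := le_of_mul_le_mul_right hu (norm_pos_iff.2 hu0)
    linarith

/-- It suffices to test the expansion at `z = G w`, where `F z = w`; composing with `F z = O(z)`
then returns to `z`. -/
theorem IsPrenormalized.inverse_expansion {k : ℕ} [NeZero k] {b : ℂ} {G F : ℂ → ℂ}
    (h : IsPrenormalized k b G) (hF : IsInverseGerm G F) :
    (fun z : ℂ => F z - (z - z ^ (k + 1) + (((k : ℂ) + 1) / 2 + b) * z ^ (2 * k + 1)))
      =o[𝓝 0] fun z : ℂ => z ^ (2 * k + 1) := by
  obtain ⟨e, he, hG⟩ := h.exists_eq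
  obtain ⟨ψ, hψ, hpow⟩ := pow_one_add_expansion k
  have hk : k ≠ 0 := NeZero.ne k
  let v : ℂ → ℂ := fun w => 1 + e w * w ^ k
  let u : ℂ → ℂ := fun w => w ^ k * v w
  have hwk : Tendsto (fun w : ℂ => w ^ k) (𝓝 0) (𝓝 0) := by
    simpa [hk] using (continuous_pow (M := ℂ) k).tendsto 0
  have hv : Tendsto v (𝓝 0) (𝓝 1) := by
    simpa using (tendsto_const_nhds (x := (1 : ℂ))).add (he.mul hwk)
  have hu : Tendsto u (𝓝 0) (𝓝 0) := by simpa using hwk.mul hv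
  let a' : ℂ := ((k : ℂ) + 1) / 2 + b
  -- The error at `G w` divided by `w ^ (2 * k + 1)`. Its limit is `(k + 1) - ((k + 1) / 2 - b) - a'
  -- = 0`, which dictates `a'`.
  let R : ℂ → ℂ := fun w => (k + 1) * v w + ψ (u w) * v w - e w - a' * (1 + u w) ^ (2 * k + 1)
  have hR : Tendsto R (𝓝 0) (𝓝 0) := by
    have h1 : Tendsto R (𝓝 0) (𝓝 (((k : ℂ) + 1) * 1 + 0 * 1 - (((k : ℂ) + 1) / 2 - b)
        - a' * (1 + 0) ^ (2 * k + 1))) :=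
      (((hv.const_mul _).add ((hψ.comp hu).mul hv)).sub he).sub
        (((hu.const_add 1).pow (2 * k + 1)).const_mul a')
    convert h1 using 2
    simp only [a']; ring
  have key : ∀ᶠ w in 𝓝 (0 : ℂ),
      w - (G w - G w ^ (k + 1) + a' * G w ^ (2 * k + 1)) = R w * w ^ (2 * k + 1) := by
    filter_upwards [hG] with w hw
    have hw' : G w = w * (1 + u w) := by
      rw [hw]; simp only [u, v]; ring
    have e1 : G w ^ (k + 1) = w ^ (k + 1) * (1 + (k + 1) * u w + ψ (u w) * u w) := by
      rw [← hpow, hw', mul_pow]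
    have e2 : G w ^ (2 * k + 1) = w ^ (2 * k + 1) * (1 + u w) ^ (2 * k + 1) := by
      rw [hw', mul_pow]
    rw [e1, e2, hw]
    simp only [R]
    rw [show (k + 1) * u w = (k + 1) * (w ^ k * v w) from rfl,
      show ψ (u w) * u w = ψ (u w) * (w ^ k * v w) from rfl]
    ring
  have hF0 : Tendsto F (𝓝 0) (𝓝 0) := by
    simpa [hF.map_zero] using hF.analyticAt.continuousAt.tendsto
  have h1 : (fun w => R w * w ^ (2 * k + 1)) =o[𝓝 0] fun w : ℂ => w ^ (2 * k + 1) := by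
    simpa using ((Asymptotics.isLittleO_one_iff ℂ).2 hR).mul_isBigO
      (Asymptotics.isBigO_refl (fun w : ℂ => w ^ (2 * k + 1)) (𝓝 0))
  have h2 := h1.comp_tendsto hF0
  have h3 : (fun z => F z ^ (2 * k + 1)) =O[𝓝 0] fun z : ℂ => z ^ (2 * k + 1) := by
    refine Asymptotics.IsBigO.pow ?_ _
    simpa [hF.map_zero] using hF.analyticAt.differentiableAt.isBigO_sub
  refine (h2.trans_isBigO h3).congr' ?_ EventuallyEq.rfl
  filter_upwards [hF0.eventually key, hF.right_inv] with z hz hz'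
  rw [hz'] at hz
  exact hz.symm

/-! ### The rotation by `exp (-i π / k)` -/

/-- The rotation factor `exp (-i π / k)`. -/
def rotationFactor (k : ℕ) : ℂ := Complex.exp (-(Real.pi * Complex.I) / k)

theorem rotationFactor_ne_zero (k : ℕ) : rotationFactor k ≠ 0 := Complex.exp_ne_zero _

theorem rotationFactor_pow (k : ℕ) [NeZero k] : rotationFactor k ^ k = -1 := by
  have hk : (k : ℂ) ≠ 0 := Nat.cast_ne_zero.2 (NeZero.ne k)
  rw [rotationFactor, ← Complex.exp_nat_mul, mul_div_cancel₀ _ hk, Complex.exp_neg,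
    Complex.exp_pi_mul_I]
  norm_num

theorem norm_rotationFactor (k : ℕ) : ‖rotationFactor k‖ = 1 := by
  have e : -(Real.pi * Complex.I) / k = ((-Real.pi / k : ℝ) : ℂ) * Complex.I := by
    push_cast; ring
  rw [rotationFactor, e, Complex.norm_exp_ofReal_mul_I]

theorem direction_add_one {k : ℕ} [NeZero k] (j : ZMod (2 * k)) :
    rotationFactor k * direction k (j + 1) = direction k j := by
  have hk : (k : ℂ) ≠ 0 := Nat.cast_ne_zero.2 (NeZero.ne k)
  have hk0 := NeZero.ne k
  have : Fact (1 < 2 * k) := ⟨by omega⟩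
  rw [rotationFactor, direction, direction, ← Complex.exp_add, Complex.exp_eq_exp_iff_exists_int]
  rcases lt_or_ge (j.val + (1 : ZMod (2 * k)).val) (2 * k) with h | h
  · refine ⟨0, ?_⟩
    rw [ZMod.val_add_of_lt h, ZMod.val_one]
    push_cast
    field_simp
    ring
  -- Wrap-around of the index: the representative drops by `2 * k`, hence the exponent by `2 π i`.
  · refine ⟨-1, ?_⟩
    have h2 := ZMod.val_add_val_of_le h
    rw [ZMod.val_one] at h2
    have h3 : (j.val : ℂ) + 1 = (j + 1).val + 2 * k := by exact_mod_cast h2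
    push_cast
    field_simp
    linear_combination -h3

/-- The germ `F` read in the rotated coordinate `y = exp (-i π / k) z`. -/
def rotated (k : ℕ) (F : ℂ → ℂ) (y : ℂ) : ℂ := rotationFactor k * F (y / rotationFactor k)

theorem mem_puncturedDisc_div {k : ℕ} {r : ℝ} {y : ℂ} :
    y / rotationFactor k ∈ puncturedDisc r ↔ y ∈ puncturedDisc r := by
  simp [puncturedDisc, rotationFactor_ne_zero, norm_rotationFactor]

theorem div_direction_add_one {k : ℕ} [NeZero k] (j : ZMod (2 * k)) (y : ℂ) :
    y / rotationFactor k / direction k (j + 1) = y / direction k j := by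
  rw [div_div, direction_add_one]

theorem mem_sector_div {k : ℕ} [NeZero k] {j : ZMod (2 * k)} {y : ℂ} :
    y / rotationFactor k ∈ sector k (j + 1) ↔ y ∈ sector k j := by
  simp [sector, div_direction_add_one, rotationFactor_ne_zero]

/-- The pole term changes sign because `ρ ^ k = -1`, while the logarithm, measured from the petal's
direction, is unchanged; so `b` must change sign. -/
theorem timeChart_div {k : ℕ} [NeZero k] (b : ℂ) (j : ZMod (2 * k)) (y : ℂ) :
    timeChart k b (j + 1) (y / rotationFactor k) = -timeChart k (-b) j y := by
  rw [timeChart, timeChart, div_direction_add_one, div_pow, rotationFactor_pow]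
  simp only [div_neg, div_one, mul_neg]
  ring

theorem step_rotated_iff {k : ℕ} {r : ℝ} {G F : ℂ → ℂ}
    (hr : ∀ z ∈ puncturedDisc r, F (G z) = z ∧ G (F z) = z) {y x : ℂ} :
    Step (rotated k F) r y x ↔ Step G r (x / rotationFactor k) (y / rotationFactor k) := by
  have h0 := rotationFactor_ne_zero k
  simp only [Step, mem_puncturedDisc_div]
  constructor
  · rintro ⟨hy, hx, rfl⟩
    refine ⟨hx, hy, ?_⟩
    rw [rotated, mul_div_cancel_left₀ _ h0, (hr _ (mem_puncturedDisc_div.2 hy)).2]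
  · rintro ⟨hx, hy, e⟩
    refine ⟨hy, hx, ?_⟩
    rw [rotated, e, (hr _ (mem_puncturedDisc_div.2 hx)).1, mul_div_cancel₀ _ h0]

theorem reflTransGen_step_rotated_iff {k : ℕ} {r : ℝ} {G F : ℂ → ℂ}
    (hr : ∀ z ∈ puncturedDisc r, F (G z) = z ∧ G (F z) = z) {y x : ℂ} :
    Relation.ReflTransGen (Step (rotated k F) r) y x ↔
      Relation.ReflTransGen (Step G r) (x / rotationFactor k) (y / rotationFactor k) := by
  have h0 := rotationFactor_ne_zero k
  constructor
  · intro h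
    induction h with
    | refl => exact .refl
    | tail _ hs ih => exact .head ((step_rotated_iff hr).1 hs) ih
  · have key : ∀ a c, Relation.ReflTransGen (Step G r) a c →
        Relation.ReflTransGen (Step (rotated k F) r) (rotationFactor k * c)
          (rotationFactor k * a) := by
      intro a c h
      induction h with
      | refl => exact .refl
      | tail _ hs ih =>
        refine .head ((step_rotated_iff hr).2 ?_) ih
        rwa [mul_div_cancel_left₀ _ h0, mul_div_cancel_left₀ _ h0]
    intro h
    have := key _ _ h
    rwa [mul_div_cancel₀ _ h0, mul_div_cancel₀ _ h0] at this

theorem Step.eq_of_right {r : ℝ} {G F : ℂ → ℂ}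
    (hr : ∀ z ∈ puncturedDisc r, F (G z) = z ∧ G (F z) = z) {p p' q : ℂ}
    (h : Step G r p q) (h' : Step G r p' q) : p = p' := by
  rw [← (hr p h.1).1, ← (hr p' h'.1).1, ← h.2.2, ← h'.2.2]

/-- A strip consists of the endpoints of steps crossing the line. The inverse traverses such a step
backwards, so its strip holds the starting points: the two strips differ by one step. -/
theorem mem_strip_rotated_iff {k : ℕ} [NeZero k] {b : ℂ} {r δ : ℝ} {G F : ℂ → ℂ}
    (hr : ∀ z ∈ puncturedDisc r, F (G z) = z ∧ G (F z) = z) {j : ZMod (2 * k)} {y : ℂ} :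
    y ∈ strip k (-b) (rotated k F) r δ j ↔
      ∃ q ∈ strip k b G r δ (j + 1), Step G r (y / rotationFactor k) q := by
  have h0 := rotationFactor_ne_zero k
  have hc : ∀ x, timeChart k (-b) j x = -timeChart k b (j + 1) (x / rotationFactor k) :=
    fun x => by rw [timeChart_div, neg_neg]
  have hδ : (δ : ℂ) * direction k j / rotationFactor k = δ * direction k (j + 1) := by
    rw [← direction_add_one j]; field_simp
  simp only [strip, Set.mem_ofPred_eq, hc, hδ, Complex.neg_re, neg_le_neg_iff,
    ← mem_sector_div (j := j), step_rotated_iff hr]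
  constructor
  · rintro ⟨hy, x, hx, hs, h1, h2⟩
    exact ⟨_, ⟨hx, _, hy, hs, h2, h1⟩, hs⟩
  · rintro ⟨q, ⟨hq, p, hp, hs, h1, h2⟩, hs'⟩
    obtain rfl := Step.eq_of_right hr hs hs'
    refine ⟨hp, rotationFactor k * q, ?_⟩
    rw [mul_div_cancel_left₀ _ h0]
    exact ⟨hq, hs, h2, h1⟩

theorem reflTransGen_step_or_iff {r : ℝ} {G F : ℂ → ℂ}
    (hr : ∀ z ∈ puncturedDisc r, F (G z) = z ∧ G (F z) = z) {p q z : ℂ} (h : Step G r p q) :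
    (Relation.ReflTransGen (Step G r) z p ∨ Relation.ReflTransGen (Step G r) p z) ↔
      (Relation.ReflTransGen (Step G r) z q ∨ Relation.ReflTransGen (Step G r) q z) := by
  constructor
  · rintro (h1 | h1)
    · exact .inl (h1.tail h)
    · rcases h1.cases_head with rfl | ⟨q', hs, h2⟩
      · exact .inl (.single h)
      · rw [h.2.2, ← hs.2.2]
        exact .inr h2
  · rintro (h1 | h1)
    · rcases h1.cases_tail with rfl | ⟨p', h2, hs⟩
      · exact .inr (.single h)
      · rw [Step.eq_of_right hr h hs]
        exact .inl h2
    · exact .inr (.head h h1)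

/-- Petals are unions of orbits, so the one-step discrepancy between the strips disappears. -/
theorem mem_petal_rotated_iff {k : ℕ} [NeZero k] {b : ℂ} {r δ : ℝ} {G F : ℂ → ℂ}
    (hr : ∀ z ∈ puncturedDisc r, F (G z) = z ∧ G (F z) = z) {j : ZMod (2 * k)} {y : ℂ} :
    y ∈ petal k (-b) (rotated k F) r δ j ↔
      y / rotationFactor k ∈ petal k b G r δ (j + 1) := by
  have h0 := rotationFactor_ne_zero k
  simp only [petal, Set.mem_ofPred_eq, reflTransGen_step_rotated_iff hr]
  constructor
  · rintro ⟨p, hp, h⟩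
    obtain ⟨q, hq, hs⟩ := (mem_strip_rotated_iff hr).1 hp
    exact ⟨q, hq, (reflTransGen_step_or_iff hr hs).1 h.symm⟩
  · rintro ⟨q, hq, h⟩
    obtain ⟨-, p, -, hs, -⟩ := id hq
    refine ⟨rotationFactor k * p, ?_⟩
    rw [mem_strip_rotated_iff hr, mul_div_cancel_left₀ _ h0]
    exact ⟨⟨q, hq, hs⟩, ((reflTransGen_step_or_iff hr hs).2 h).symm⟩

theorem petal_subset_puncturedDisc {k : ℕ} {b : ℂ} {r δ : ℝ} {G : ℂ → ℂ} {j : ZMod (2 * k)} :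
    petal k b G r δ j ⊆ puncturedDisc r := by
  rintro z ⟨p, ⟨-, w, -, hs, -⟩, h | h⟩
  · rcases h.cases_head with rfl | ⟨_, hs', -⟩
    exacts [hs.2.1, hs'.1]
  · rcases h.cases_tail with rfl | ⟨_, -, hs'⟩
    exacts [hs.2.1, hs'.2.1]

/-! ### Fatou coordinates of the rotated inverse; regularity of transition functions. -/

theorem IsFatouCoordinate.rotated {k : ℕ} {r : ℝ} {S S' : Set ℂ} {G F φ : ℂ → ℂ}
    (h : IsFatouCoordinate G S φ)
    (hr : ∀ z ∈ puncturedDisc r, F (G z) = z ∧ G (F z) = z) (hS : S ⊆ puncturedDisc r)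
    (hS' : ∀ y, y ∈ S' ↔ y / rotationFactor k ∈ S) :
    IsFatouCoordinate (rotated k F) S' fun y => -φ (y / rotationFactor k) := by
  have h0 := rotationFactor_ne_zero k
  have hcont : Continuous fun y : ℂ => y / rotationFactor k := by fun_prop
  have hpre : S' = (fun y : ℂ => y / rotationFactor k) ⁻¹' S := Set.ext hS'
  have hd : ∀ y ∈ S', HasDerivAt (fun y => -φ (y / rotationFactor k))
      (-(deriv φ (y / rotationFactor k) * (1 / rotationFactor k))) y := by
    intro y hy
    have h1 := (h.differentiableOn.differentiableAt
      (h.isOpen.mem_nhds ((hS' y).1 hy))).hasDerivAt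
    exact (h1.comp y ((hasDerivAt_id y).div_const (rotationFactor k))).neg
  refine ⟨hpre ▸ h.isOpen.preimage hcont,
    fun y hy => (hd y hy).differentiableAt.differentiableWithinAt, ?_, ?_, ?_⟩
  · intro x hx y hy hxy
    have := h.injOn ((hS' x).1 hx) ((hS' y).1 hy) (neg_injective hxy)
    exact (div_left_inj' h0).1 this
  · intro y hy
    rw [(hd y hy).deriv]
    exact neg_ne_zero.2 (mul_ne_zero (h.deriv_ne_zero _ ((hS' y).1 hy)) (one_div_ne_zero h0))
  · intro y hy hy'
    have h1 := (hS' _).1 hy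
    have h2 := (hS' _).1 hy'
    rw [EcalleVoronin.rotated, mul_div_cancel_left₀ _ h0] at h2 ⊢
    have h3 := h.abel _ h2
    rw [(hr _ (hS h1)).2] at h3
    rw [h3 h1]
    ring

/-- A map given on a neighbourhood of a point as `φ' ∘ φ⁻¹` is holomorphic there. -/
theorem differentiableAt_transition {S S' : Set ℂ} {φ φ' Ψ : ℂ → ℂ} {W : ℂ}
    (hS : IsOpen S) (hφ : DifferentiableOn ℂ φ S) (hinj : Set.InjOn φ S)
    (hd : ∀ z ∈ S, deriv φ z ≠ 0) (hS' : IsOpen S') (hφ' : DifferentiableOn ℂ φ' S')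
    (h : ∀ᶠ V in 𝓝 W, ∃ z ∈ S ∩ S', φ z = V ∧ φ' z = Ψ V) : DifferentiableAt ℂ Ψ W := by
  obtain ⟨z, ⟨hz, hz'⟩, rfl, -⟩ := h.self_of_nhds
  have hs := (hφ.analyticAt (hS.mem_nhds hz)).hasStrictDerivAt
  have hl := (hs.to_localInverse (hd z hz)).hasDerivAt
  have hlz : hs.localInverse _ _ _ (hd z hz) (φ z) = z :=
    (hs.eventually_left_inverse (hd z hz)).self_of_nhds
  -- Keeps the local inverse inside `S`, where injectivity of `φ` identifies it with the point given
  -- by `h`.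
  have hmem := hl.continuousAt.tendsto.eventually
    (by rw [hlz]; exact hS.mem_nhds hz)
  have hcomp : DifferentiableAt ℂ (φ' ∘ hs.localInverse _ _ _ (hd z hz)) (φ z) := by
    refine DifferentiableAt.comp _ ?_ hl.differentiableAt
    rw [hlz]
    exact hφ'.differentiableAt (hS'.mem_nhds hz')
  refine hcomp.congr_of_eventuallyEq ?_
  filter_upwards [h, hmem, hs.eventually_right_inverse (hd z hz)] with V hV hV' hV''
  obtain ⟨w, ⟨hw, -⟩, e, e'⟩ := hV
  rw [Function.comp_apply, ← e', hinj hV' hw (hV''.trans e.symm)]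

/-- A single choice of `r` and `δ` suffices. Equal values of `Ψ n` force equal points, since the
target coordinate is injective. -/
theorem IsTransitionTuple.isGermIso {k : ℕ} {b : ℂ} {G : ℂ → ℂ} {Ψ : TransitionTuple k}
    (h : IsTransitionTuple k b G Ψ) (hN : IsNormalized k b Ψ) (n : ZMod (2 * k)) :
    IsGermIso (hornEnd k n) (Ψ n) := by
  obtain ⟨r, hr⟩ := h.exists
  obtain ⟨δ, φ, hφ, hΨ⟩ := hr.exists
  have hs := hφ (sourcePetal k n)
  have ht := hφ (targetPetal k n)
  refine ⟨⟨_, hΨ n, ?_⟩, hornEnd_le_map ?_ (hN n)⟩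
  · rintro V ⟨z, hz, rfl, e⟩ V' ⟨z', hz', rfl, e'⟩ hVV'
    rw [ht.injOn hz.2 hz'.2 (by rw [e, e', hVV'])]
  · filter_upwards [hornEnd_eventually_closedBall (hΨ n) 1] with W hW
    refine differentiableAt_transition hs.isOpen hs.differentiableOn hs.injOn hs.deriv_ne_zero
      ht.isOpen ht.differentiableOn ?_
    filter_upwards [Metric.closedBall_mem_nhds W one_pos] with V hV using hW V hV

/-! ### The inverse tuple: normalization, equivalence, realization by the rotated inverse. -/

theorem inverseTuple_apply {k : ℕ} (Ψ : TransitionTuple k) (n : ZMod (2 * k)) (W : ℂ) :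
    inverseTuple Ψ n W = -germInverse (hornEnd k (n + 1)) (Ψ (n + 1)) (-W) := rfl

/-- Writing `-W = Ψ (n + 1) U` gives `inverseTuple Ψ n W - W = Ψ (n + 1) U - U`. -/
theorem IsNormalized.inverseTuple {k : ℕ} [NeZero k] {b : ℂ} {Ψ : TransitionTuple k}
    (hN : IsNormalized k b Ψ) (hiso : ∀ n, IsGermIso (hornEnd k n) (Ψ n)) :
    IsNormalized k (-b) (inverseTuple Ψ) := by
  intro n
  rw [← normalizedConstant_add_one]
  have h1 := ((hN (n + 1)).comp (hiso (n + 1)).tendsto_germInverse).comp (tendsto_neg_hornEnd n)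
  refine h1.congr' ?_
  filter_upwards [(tendsto_neg_hornEnd n).eventually
    ((hiso (n + 1)).eventually_germInverse (p := fun _ => True) (by simp))] with W hW
  simp only [Function.comp_apply, hW.2, inverseTuple_apply]
  ring

theorem Equivalent.inverseTuple {k : ℕ} [NeZero k] {Ψ Ψ' : TransitionTuple k}
    (h : Equivalent Ψ Ψ') (hiso : ∀ n, IsGermIso (hornEnd k n) (Ψ' n)) :
    Equivalent (inverseTuple Ψ) (inverseTuple Ψ') := by
  obtain ⟨m, C, h⟩ := h
  -- Conjugation by `W ↦ -W` turns the translation by `C` into the one by `-C`.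
  refine ⟨m, -C, fun n => ?_⟩
  have hl : hornEnd k (n + 1 + 2 * m) = hornEnd k (n + 1) := hornEnd_add_two_mul _ _
  have hiso1 := hiso (n + 1 + 2 * m)
  rw [hl] at hiso1
  have hisoΨ := (hiso1.conj_add (tendsto_sub_hornEnd _ C) (tendsto_add_hornEnd _ C)).congr
    (h (n + 1)).symm
  have h1 := (h (n + 1)).and
    ((tendsto_sub_hornEnd (n + 1) C).eventually (germInverse_comp hiso1.injOn))
  filter_upwards [(tendsto_neg_hornEnd n).eventually (hisoΨ.eventually_germInverse h1)] with W hW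
  obtain ⟨⟨e1, e2⟩, e3⟩ := hW
  have en : n + 2 * m + 1 = n + 1 + 2 * m := by ring
  rw [inverseTuple_apply, inverseTuple_apply, en, hl]
  have e4 : -(W - -C) = Ψ' (n + 1 + 2 * m)
      (germInverse (hornEnd k (n + 1)) (Ψ (n + 1)) (-W) - C) := by
    linear_combination e3.symm.trans e1
  rw [e4, e2]
  ring

theorem IsTransitionTuple.inverseTuple {k : ℕ} [NeZero k] {b : ℂ} {G F : ℂ → ℂ}
    {Ψ : TransitionTuple k} (h : IsTransitionTuple k b G Ψ) (hF : IsInverseGerm G F)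
    (hiso : ∀ n, IsGermIso (hornEnd k n) (Ψ n)) :
    IsTransitionTuple k (-b) (rotated k F) (inverseTuple Ψ) := by
  have h0 := rotationFactor_ne_zero k
  have hsmall : ∀ᶠ r in 𝓝[>] (0 : ℝ), ∀ z ∈ puncturedDisc r, F (G z) = z ∧ G (F z) = z := by
    obtain ⟨ε, hε, hball⟩ := Metric.eventually_nhds_iff_ball.1 (hF.left_inv.and hF.right_inv)
    filter_upwards [Ioo_mem_nhdsGT hε] with r hr z hz
    exact hball z (by simpa using hz.2.trans hr.2)
  filter_upwards [h, hsmall] with r hr hrF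
  filter_upwards [hr] with δ ⟨φ, hφ, hΨ⟩
  refine ⟨fun j y => -φ (j + 1) (y / rotationFactor k),
    fun j => (hφ (j + 1)).rotated hrF petal_subset_puncturedDisc
      fun y => mem_petal_rotated_iff hrF, fun n => ?_⟩
  filter_upwards [(tendsto_neg_hornEnd n).eventually
    ((hiso (n + 1)).eventually_germInverse (hΨ (n + 1)))] with W hW
  obtain ⟨⟨z, hz, e1, e2⟩, e3⟩ := hW
  -- The same point `z` of the overlap serves for `F`, with source and target interchanged.
  rw [sourcePetal_add_one, targetPetal_add_one] at *
  refine ⟨rotationFactor k * z, ⟨?_, ?_⟩, ?_, ?_⟩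
  · rw [mem_petal_rotated_iff hrF, mul_div_cancel_left₀ _ h0]
    exact hz.2
  · rw [mem_petal_rotated_iff hrF, mul_div_cancel_left₀ _ h0]
    exact hz.1
  · rw [mul_div_cancel_left₀ _ h0, e2, e3, neg_neg]
  · rw [mul_div_cancel_left₀ _ h0, e1, inverseTuple_apply]

/-- Rotation multiplies the coefficient of `z ^ (k + 1)` by `ρ ^ (-k) = -1` and that of `z ^ (2 * k
+ 1)` by `ρ ^ (-2 * k) = 1`. -/
theorem IsPrenormalized.rotated_inverse {k : ℕ} [NeZero k] {b : ℂ} {G F : ℂ → ℂ}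
    (h : IsPrenormalized k b G) (hF : IsInverseGerm G F) :
    IsPrenormalized k (-b) (rotated k F) := by
  have h0 := rotationFactor_ne_zero k
  have hp := rotationFactor_pow k
  have ht : Tendsto (fun y : ℂ => y / rotationFactor k) (𝓝 0) (𝓝 0) := by
    simpa using (continuous_id.div_const (rotationFactor k)).tendsto 0
  refine ⟨?_, ?_⟩
  · have h1 : AnalyticAt ℂ (fun y : ℂ => y / rotationFactor k) 0 := by fun_prop
    have h2 : AnalyticAt ℂ F (0 / rotationFactor k) := by simpa using hF.analyticAt
    exact analyticAt_const.mul (AnalyticAt.comp (f := fun y : ℂ => y / rotationFactor k) h2 h1)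
  · have h1 := ((h.inverse_expansion hF).comp_tendsto ht).const_mul_left (rotationFactor k)
    have e2 : rotationFactor k ^ (2 * k) = 1 := by rw [mul_comm, pow_mul, hp]; norm_num
    have h2 : ((fun z : ℂ => z ^ (2 * k + 1)) ∘ fun y => y / rotationFactor k)
        =O[𝓝 0] fun y : ℂ => y ^ (2 * k + 1) := by
      refine Asymptotics.IsBigO.of_bound 1 (Eventually.of_forall fun y => ?_)
      simp [norm_rotationFactor]
    refine (h1.trans_isBigO h2).congr_left fun y => ?_
    simp only [Function.comp_apply, rotated, div_pow, pow_succ, hp, e2]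
    field_simp
    ring

end EcalleVoronin

end
theorem mainTheorem11 (g ginv : ℂ → ℂ)
    (hg : EcalleVoronin.IsParabolicGerm g)
    (hinv : EcalleVoronin.IsInverseGerm g ginv)
    (k : ℕ) (b : ℂ) (Ψ : EcalleVoronin.TransitionTuple k)
    (hmod : EcalleVoronin.HasModulus g ⟨k, b, ⟦Ψ⟧⟩) :
    EcalleVoronin.HasModulus ginv ⟨k, -b, ⟦EcalleVoronin.inverseTuple Ψ⟧⟩ := by
  obtain ⟨hk, h, G, hh, hh0, hh', hconj, hG, Ψ₀, hΨ₀, hN, hclass⟩ := hmod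
  dsimp only at hk hG Ψ₀ hΨ₀ hN hclass
  have : NeZero k := ⟨by omega⟩
  obtain ⟨F, hF⟩ := hG.exists_inverse
  have hiso := hΨ₀.isGermIso hN
  have h0 := EcalleVoronin.rotationFactor_ne_zero k
  refine ⟨hk, fun z => EcalleVoronin.rotationFactor k * h z, EcalleVoronin.rotated k F,
    analyticAt_const.mul hh, by simp [hh0], ?_, ?_, hG.rotated_inverse hF,
    EcalleVoronin.inverseTuple Ψ₀, hΨ₀.inverseTuple hF hiso, hN.inverseTuple hiso,
    -- `Ψ` is only equivalent to the realized tuple `Ψ₀`, so compatibility of inversion with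
    -- equivalence is needed.
    Quotient.sound ((Quotient.exact hclass).inverseTuple hiso)⟩
  · rw [deriv_const_mul _ hh.differentiableAt]
    exact mul_ne_zero h0 hh'
  · have hcont : Tendsto ginv (𝓝 0) (𝓝 0) := by
      simpa [hinv.map_zero] using hinv.analyticAt.continuousAt.tendsto
    have hh_cont : Tendsto h (𝓝 0) (𝓝 0) := by
      simpa [hh0] using hh.continuousAt.tendsto
    -- The conjugacy at `ginv z` reads `h z = G (h (ginv z))`; applying `F` gives `h (ginv z) = F (h
    -- z)`.
    filter_upwards [hinv.right_inv, hcont.eventually hconj,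
      (hh_cont.comp hcont).eventually hF.left_inv] with z h1 h2 h3
    rw [h1] at h2
    rw [EcalleVoronin.rotated, mul_div_cancel_left₀ _ h0, h2]
    exact congrArg _ h3.symm
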